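/- Let $m,q\ge 2$, $n=d=mq$ and $\lambda\ge 0$. There are $n$ reviewers and $d$ papers, and a similarity matrix $S\in[0,1]^{n\times d}$. The reviewers arrive one after the other, each exactly once, in an arbitrary order. On arrival, reviewer $i$ is shown all papers in an ordering $\pi_i$, where $\pi_i(j)\in\{1,\dots,d\}$ is the position of paper $j$, and then bids independently on each paper $j$ with probability $f(\pi_i(j),S_{i,j})$. An algorithm chooses $\pi_i$, possibly at random, on the basis of $S$, the identity of the arriving reviewer, and the past arrivals with their orderings and bids. If $g_j$ is the final number of bids on paper $j$, the gain is $\mathcal G=\sum_{j}\gamma_p(g_j)+\lambda\sum_{i}\sum_{j}\gamma_r(\pi_i(j),S_{i,j})$. An algorithm is optimal if no algorithm has a larger expected gain $\mathbb E[\mathcal G]$, and it is suboptimal by at least $\delta$ if some algorithm has an expected gain larger by at least $\delta$. The noiseless community model consists of the matrices $S=P(sB)\widetilde P$, where $s\in[0.01,1]$, $B$ is the $mq\times mq$ block diagonal matrix with $m$ diagonal blocks equal to the all-ones $q\times q$ matrix (and zeros elsewhere), and $P,\widetilde P$ are permutation matrices. Take $$\gamma_p(x)=\sqrt{x},\qquad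 \gamma_r(k,x)=\frac{2^{x}-1}{\log_2(k+1)},\qquad f(k,x)=\mathbf 1\{k=1\}\,\mathbf 1\{x>s/2\}.$$ Consider the following algorithms; $g_{i-1,j}$ denotes the number of bids on paper $j$ before the arrival of the current reviewer $i$. - SUPER* with zero heuristic computes the weights $w_{j,k}=\lambda\gamma_r(k,S_{i,j})+f(k,S_{i,j})\big(\gamma_p(g_{i-1,j}+1)-\gamma_p(g_{i-1,j})\big)$, takes a solution $x^*$ of the linear program that maximizes $\sum_{j,k}w_{j,k}x_{j,k}$ over all doubly stochastic $x\in[0,1]^{d\times d}$, with $x^*$ a permutation matrix and ties broken arbitrarily, and sets $\pi_i(j)=k$ where $x^*_{j,k}=1$. - SIM shows the papers in decreasing order of $S_{i,j}$; ties are broken in favour of fewer bids, further ties uniformly at random. - BID shows the papers in increasing order of $g_{i-1,j}$; ties are broken in favour of higher similarity, further ties uniformly at random. - RAND shows every reviewer an independent, uniformly random ordering. Then, for all $m,q\ge2$ and $\lambda\ge0$, every $S$ in the noiseless community model and every order of arrival: (a) SUPER* with zero heuristic is optimal (for every tie-breaking rule); (b) SIM is optimal. In contrast, there is a constant $c>0$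 such that for all $m,q\ge2$, $\lambda\ge0$, every $S$ in the noiseless community model and every order of arrival: (c) BID is suboptimal by at least $c\lambda d/\log_2^2(d)$; (d) RAND is suboptimal by at least $cd$. -/

import Mathlib

/-! ## Bidding model, histories, algorithms -/

/-- The data of the sequential bidding problem: a paper-side gain function, a reviewer-side gain
function (arguments: position `1, 2, …` and similarity), a bidding function (same arguments,
values are probabilities) and a trade-off parameter. -/
structure BiddingModel where
  paperGain : ℝ → ℝ
  reviewerGain : ℕ → ℝ → ℝ
  bidProb : ℕ → ℝ → unitInterval
  tradeoff : ℝ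

/-- An ordering of `d` papers: `π j` is the (zero-based) place at which paper `j` is shown. -/
abbrev PaperOrder (d : ℕ) : Type := Equiv.Perm (Fin d)

/-- The (one-based) position of paper `j` in the ordering `π`. -/
def position {d : ℕ} (π : PaperOrder d) (j : Fin d) : ℕ := (π j : ℕ) + 1

/-- What is observed about one arrival: the identity of the reviewer, the ordering that was shown,
and the papers on which the reviewer bid. -/
structure Arrival (n d : ℕ) where
  reviewer : Fin n
  order : PaperOrder d
  bids : Fin d → Bool

/-- The list of past arrivals, the earliest first. -/
abbrev History (n d : ℕ) : Type := List (Arrival n d)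

/-- The number of bids that paper `j` has received so far. -/
def bidCount {n d : ℕ} (H : History n d) (j : Fin d) : ℕ := H.countP (fun a => a.bids j)

/-- A (randomized) algorithm, for a fixed similarity matrix: given the history and the
identity of the arriving reviewer, it produces a probability distribution on orderings. -/
abbrev Algorithm (n d : ℕ) : Type := History n d → Fin n → PMF (PaperOrder d)

/-- The joint law of independent Bernoulli variables with success probabilities `p j`. -/
noncomputable def independentBids {d : ℕ} (p : Fin d → unitInterval) : PMF (Fin d → Bool) :=
  PMF.ofFintype
    (fun b => ∏ j, if b j then ENNReal.ofReal (p j) else ENNReal.ofReal (1 - p j)) (by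
      have h := (Finset.prod_univ_sum (fun _ : Fin d => (Finset.univ : Finset Bool))
        (fun j c => if c then ENNReal.ofReal (p j : ℝ) else ENNReal.ofReal (1 - p j : ℝ))).symm
      rw [Fintype.piFinset_univ] at h
      rw [h]
      refine Finset.prod_eq_one fun j _ => ?_
      rw [Fintype.sum_bool]
      simp only [if_true, Bool.false_eq_true, if_false]
      rw [← ENNReal.ofReal_add (p j).2.1 (sub_nonneg.2 (p j).2.2)]
      simp)

/-- The law of the history at the end of the process, if the reviewers in the list `l` arrive
one after the other (in this order) after the history `H`. -/
noncomputable def run {n d : ℕ} (M : BiddingModel) (S : Matrix (Fin n) (Fin d) ℝ)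
    (A : Algorithm n d) : List (Fin n) → History n d → PMF (History n d)
  | [], H => PMF.pure H
  | i :: l, H =>
      (A H i).bind fun π =>
        (independentBids fun j => M.bidProb (position π j) (S i j)).bind fun b =>
          run M S A l (H ++ [⟨i, π, b⟩])

/-- Only finitely many final histories have positive probability, so that expectations are finite
sums. -/
theorem run_support_finite {n d : ℕ} (M : BiddingModel) (S : Matrix (Fin n) (Fin d) ℝ)
    (A : Algorithm n d) (l : List (Fin n)) (H : History n d) :
    (run M S A l H).support.Finite := by
  induction l generalizing H with
  | nil => simp [run]
  | cons i l ih =>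
    rw [run, PMF.support_bind]
    refine Set.Finite.biUnion (Set.toFinite _) fun π _ => ?_
    rw [PMF.support_bind]
    exact Set.Finite.biUnion (Set.toFinite _) fun b _ => ih _

/-- The overall gain of a complete history: paper-side gain plus trade-off parameter times
reviewer-side gain. -/
noncomputable def gain {n d : ℕ} (M : BiddingModel) (S : Matrix (Fin n) (Fin d) ℝ)
    (H : History n d) : ℝ :=
  (∑ j : Fin d, M.paperGain (bidCount H j)) +
    M.tradeoff *
      (H.map fun a => ∑ j : Fin d, M.reviewerGain (position a.order j) (S a.reviewer j)).sum

/-- The expected overall gain of an algorithm, when every reviewer arrives exactly once, in the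
order `σ 0, σ 1, …`; the expectation is over the bids and over the randomness of the algorithm. -/
noncomputable def expectedGain {n d : ℕ} (M : BiddingModel) (S : Matrix (Fin n) (Fin d) ℝ)
    (σ : Equiv.Perm (Fin n)) (A : Algorithm n d) : ℝ :=
  ∑' H : History n d, (run M S A (List.ofFn σ) [] H).toReal * gain M S H

/-- No algorithm has a larger expected gain. -/
def IsOptimal {n d : ℕ} (M : BiddingModel) (S : Matrix (Fin n) (Fin d) ℝ)
    (σ : Equiv.Perm (Fin n)) (A : Algorithm n d) : Prop :=
  ∀ A' : Algorithm n d, expectedGain M S σ A' ≤ expectedGain M S σ A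

/-- The expected gain falls short of the best possible one by at least `δ`. -/
def IsSuboptimalBy {n d : ℕ} (M : BiddingModel) (S : Matrix (Fin n) (Fin d) ℝ)
    (σ : Equiv.Perm (Fin n)) (A : Algorithm n d) (δ : ℝ) : Prop :=
  ∃ A' : Algorithm n d, expectedGain M S σ A + δ ≤ expectedGain M S σ A'

/-! ## The baselines -/

/-- The orderings that show the papers in increasing order of the key (papers with equal keys in
any relative order). -/
noncomputable def sortedOrderings {d : ℕ} {α : Type*} [LinearOrder α] (key : Fin d → α) :
    Finset (PaperOrder d) := by
  classical exact Finset.univ.filter fun π => ∀ j k, key j < key k → π j < π k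

theorem sortedOrderings_nonempty {d : ℕ} {α : Type*} [LinearOrder α] (key : Fin d → α) :
    (sortedOrderings key).Nonempty := by
  refine ⟨(Tuple.sort key).symm, ?_⟩
  simp only [sortedOrderings, Finset.mem_filter, Finset.mem_univ, true_and]
  intro j k hjk
  by_contra hcon
  have h := Tuple.monotone_sort key (not_lt.1 hcon)
  simp only [Function.comp_apply, Equiv.apply_symm_apply] at h
  exact absurd hjk (not_lt.2 h)

/-- RAND: every reviewer is shown an independent uniformly random ordering. -/
noncomputable def randAlg (n d : ℕ) : Algorithm n d :=
  fun _ _ => PMF.uniformOfFintype (PaperOrder d)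

/-- SIM: decreasing similarity; ties are broken in favour of fewer bids, further ties uniformly
at random. -/
noncomputable def simAlg {n d : ℕ} (S : Matrix (Fin n) (Fin d) ℝ) : Algorithm n d :=
  fun H i =>
    PMF.uniformOfFinset
      (sortedOrderings fun j => (toLex (OrderDual.toDual (S i j), bidCount H j) : ℝᵒᵈ ×ₗ ℕ))
      (sortedOrderings_nonempty _)

/-- BID: increasing number of bids; ties are broken in favour of higher similarity, further ties
uniformly at random. -/
noncomputable def bidAlg {n d : ℕ} (S : Matrix (Fin n) (Fin d) ℝ) : Algorithm n d :=
  fun H i =>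
    PMF.uniformOfFinset
      (sortedOrderings fun j => (toLex (bidCount H j, OrderDual.toDual (S i j)) : ℕ ×ₗ ℝᵒᵈ))
      (sortedOrderings_nonempty _)

/-! ## The algorithm SUPER* -/

/-- For every history and arriving reviewer, an estimate of the number of future bids on each
paper. -/
abbrev Heuristic (n d : ℕ) : Type := History n d → Fin n → Fin d → ℝ

def zeroHeuristic (n d : ℕ) : Heuristic n d := fun _ _ _ => 0

/-- The weight of showing paper `j` at (zero-based) place `k` to the arriving reviewer `i`. -/
noncomputable def superWeight {n d : ℕ} (M : BiddingModel) (S : Matrix (Fin n) (Fin d) ℝ)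
    (h : Heuristic n d) (H : History n d) (i : Fin n) (j k : Fin d) : ℝ :=
  M.tradeoff * M.reviewerGain ((k : ℕ) + 1) (S i j) +
    (M.bidProb ((k : ℕ) + 1) (S i j) : ℝ) *
      (M.paperGain (bidCount H j + h H i j + 1) - M.paperGain (bidCount H j + h H i j))

/-- `x` solves the assignment linear program with weights `w`: it maximizes
`∑ j, ∑ k, w j k * x j k` over all doubly stochastic matrices. -/
def IsAssignmentSolution {d : ℕ} (w : Fin d → Fin d → ℝ) (x : Matrix (Fin d) (Fin d) ℝ) : Prop :=
  x ∈ doublyStochastic ℝ (Fin d) ∧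
    ∀ y ∈ doublyStochastic ℝ (Fin d), ∑ j, ∑ k, w j k * y j k ≤ ∑ j, ∑ k, w j k * x j k

/-- `π` is an ordering read off from a solution `x` of the assignment linear program, by placing
`j` at `k` where `x j k = 1`. -/
def IsPaperOrder {d : ℕ} (w : Fin d → Fin d → ℝ) (π : PaperOrder d) : Prop :=
  ∃ x : Matrix (Fin d) (Fin d) ℝ, IsAssignmentSolution w x ∧ ∀ j, x j (π j) = 1

/-- `A` is SUPER* with heuristic `h`, for some tie-breaking rule (possibly random): every ordering
which it may show is read off from a solution of the assignment linear program. -/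
def IsSuperStar {n d : ℕ} (M : BiddingModel) (S : Matrix (Fin n) (Fin d) ℝ)
    (h : Heuristic n d) (A : Algorithm n d) : Prop :=
  ∀ H i, ∀ π ∈ (A H i).support, IsPaperOrder (superWeight M S h H i) π

/-- The assignment linear program has integral solutions, so an ordering can be read off. -/
theorem exists_isPaperOrder {d : ℕ} (w : Fin d → Fin d → ℝ) :
    ∃ π : PaperOrder d, IsPaperOrder w π := by
  obtain ⟨π, -, hπ⟩ := Finset.exists_max_image (Finset.univ : Finset (PaperOrder d))
    (fun π => ∑ j, w j (π j)) Finset.univ_nonempty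
  have hval : ∀ τ : PaperOrder d,
      ∑ j, ∑ k, w j k * (τ.permMatrix ℝ) j k = ∑ j, w j (τ j) := by
    intro τ
    refine Finset.sum_congr rfl fun j _ => ?_
    simp [Equiv.Perm.permMatrix, PEquiv.toMatrix_apply]
  refine ⟨π, π.permMatrix ℝ, ⟨permMatrix_mem_doublyStochastic, fun y hy => ?_⟩, fun j => by
    simp [Equiv.Perm.permMatrix, PEquiv.toMatrix_apply]⟩
  obtain ⟨c, hc0, hc1, rfl⟩ := exists_eq_sum_perm_of_mem_doublyStochastic hy
  have hlin : ∑ j, ∑ k, w j k * (∑ τ, c τ • τ.permMatrix ℝ : Matrix (Fin d) (Fin d) ℝ) j k =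
      ∑ τ, c τ * ∑ j, w j (τ j) := by
    simp_rw [← hval, Matrix.sum_apply, Matrix.smul_apply, smul_eq_mul, Finset.mul_sum]
    calc _ = ∑ j, ∑ τ : PaperOrder d, ∑ k, w j k * (c τ * τ.permMatrix ℝ j k) :=
          Finset.sum_congr rfl fun j _ => Finset.sum_comm
      _ = ∑ τ : PaperOrder d, ∑ j, ∑ k, w j k * (c τ * τ.permMatrix ℝ j k) := Finset.sum_comm
      _ = _ := Finset.sum_congr rfl fun τ _ => Finset.sum_congr rfl fun j _ =>
          Finset.sum_congr rfl fun k _ => by ring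
  rw [hlin, hval]
  calc ∑ τ, c τ * ∑ j, w j (τ j) ≤ ∑ τ, c τ * ∑ j, w j (π j) :=
        Finset.sum_le_sum fun τ _ => mul_le_mul_of_nonneg_left (hπ τ (Finset.mem_univ _)) (hc0 τ)
    _ = ∑ j, w j (π j) := by rw [← Finset.sum_mul, hc1, one_mul]

/-- SUPER* exists for every heuristic. -/
theorem exists_isSuperStar {n d : ℕ} (M : BiddingModel) (S : Matrix (Fin n) (Fin d) ℝ)
    (h : Heuristic n d) : ∃ A : Algorithm n d, IsSuperStar M S h A := by
  choose π hπ using fun (H : History n d) (i : Fin n) =>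
    exists_isPaperOrder (superWeight M S h H i)
  refine ⟨fun H i => PMF.pure (π H i), fun H i τ hτ => ?_⟩
  rw [PMF.mem_support_pure_iff] at hτ
  exact hτ ▸ hπ H i

/-! ## The noiseless community model -/

/-- The `mq × mq` block diagonal matrix with `m` diagonal blocks, each the `q × q` all-ones
matrix. -/
def communityBlocks (m q : ℕ) : Matrix (Fin (m * q)) (Fin (m * q)) ℝ :=
  Matrix.of fun i j => if (i : ℕ) / q = (j : ℕ) / q then 1 else 0

/-- The similarity matrices `P (s B) P'` with permutation matrices `P`, `P'`. -/
def noiselessCommunity (m q : ℕ) (s : ℝ) : Set (Matrix (Fin (m * q)) (Fin (m * q)) ℝ) :=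
  {S | ∃ ρ τ : Equiv.Perm (Fin (m * q)),
    S = ρ.permMatrix ℝ * (s • communityBlocks m q) * τ.permMatrix ℝ}

/-- Square-root paper-side gain, DCG reviewer-side gain, and bidding exactly on the paper in
the highest position, provided that its similarity exceeds `s / 2`. -/
noncomputable def communityModel (s lam : ℝ) : BiddingModel where
  paperGain g := Real.sqrt g
  reviewerGain k x := ((2 : ℝ) ^ x - 1) / Real.logb 2 ((k : ℝ) + 1)
  bidProb k x := by classical exact if k = 1 ∧ s / 2 < x then 1 else 0
  tradeoff := lam

/-!
In the community model all bids are deterministic: a reviewer bids on the paper in the first place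
if it belongs to the same community, and on nothing else (`IsCommunityMatrix.run_cons`). Moreover,
the gain of a history grows in each step by the objective of SUPER* with zero heuristic at the
ordering that is shown (`IsCommunityMatrix.gain_concat`). This `stepGain` is the discounted
reviewer-side gain, which is largest if the `q` papers of the community come first, plus the increase
of `√g` for the top paper, which is at most `1`, with equality if the paper had no bid. So no step
gains more than `maxStepGain`, whatever the algorithm does (`IsCommunityMatrix.expectedGain_le`).

SIM attains this bound in every step. It shows the papers of the community first, a paper with fewest
bids at the top, and that paper has no bid: only the at most `q - 1` earlier reviewers of the
community can have bid on its `q` papers (`IsCommunityMatrix.exists_bidCount_eq_zero`). SUPER*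
maximizes the step gain, so it does at least as well as the ordering of SIM. Hence both are optimal.

RAND shows a paper of the right community at the top with probability `q / d ≤ 1 / 2`, so each step
loses at least `1 / 2` in expectation (`IsCommunityMatrix.expectedGain_randAlg_le`).

For BID, consider the first `T = d - q - ⌊q / 8⌋ + 1` arrivals. At each of them at least
`q + ⌊q / 8⌋` papers have no bid. If some paper of the community of the arriving reviewer already has
a bid, it is shown after all of those, and this displacement from among the first `q` places costs
`discount (q - 1) - discount (q + ⌊q / 8⌋)`, which is of the order `1 / log₂ ² d`
(`le_displacementLoss`). If no paper of the community has a bid, the step creates the first one; this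
happens at most `m` times. So at least `T - m ≥ 3 d / 16` steps lose that much
(`IsCommunityMatrix.expectedGain_bidAlg_le`).
-/

section

open Finset

/-! ### Communities and deterministic bids -/

theorem independentBids_eq_pure {d : ℕ} {p : Fin d → unitInterval} {b : Fin d → Bool}
    (h : ∀ j, p j = if b j then 1 else 0) : independentBids p = PMF.pure b := by
  ext b'
  rw [independentBids, PMF.ofFintype_apply, PMF.pure_apply]
  split_ifs with hb
  · subst hb
    refine Finset.prod_eq_one fun j _ => ?_
    rw [h j]
    by_cases hj : b' j <;> simp [hj]
  · obtain ⟨j, hj⟩ := Function.ne_iff.1 hb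
    refine Finset.prod_eq_zero (Finset.mem_univ j) ?_
    rw [h j]
    cases hb' : b' j <;> cases hb'' : b j <;> simp_all

/-- `S` has the value `s` if the reviewer and the paper belong to the same community (with label
`cr i` and `cp j`, respectively), and `0` otherwise; each community has `q` reviewers and `q`
papers. -/
structure IsCommunityMatrix {n d m : ℕ} (q : ℕ) (s : ℝ) (S : Matrix (Fin n) (Fin d) ℝ)
    (cr : Fin n → Fin m) (cp : Fin d → Fin m) : Prop where
  card_reviewers : ∀ c, #{i | cr i = c} = q
  card_papers : ∀ c, #{j | cp j = c} = q
  apply : ∀ i j, S i j = if cr i = cp j then s else 0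

theorem card_filter_div_eq (m q : ℕ) (c : ℕ) (hc : c < m) :
    #{i : Fin (m * q) | (i : ℕ) / q = c} = q := by
  rcases Nat.eq_zero_or_pos q with rfl | hq
  · rw [Finset.card_eq_zero]
    ext i
    exact (Nat.not_lt_zero _ i.2).elim
  have : (univ.filter fun i : Fin (m * q) => (i : ℕ) / q = c).map Fin.valEmbedding
      = Finset.Ico (c * q) ((c + 1) * q) := by
    ext x
    simp only [Finset.mem_map, Finset.mem_filter, Finset.mem_univ, true_and, Fin.valEmbedding_apply,
      Finset.mem_Ico]
    constructor
    · rintro ⟨i, hi, rfl⟩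
      rw [Nat.div_eq_iff hq] at hi
      rw [Nat.succ_mul]
      omega
    · intro hx
      have hlt : x < m * q := hx.2.trans_le (Nat.mul_le_mul_right q hc)
      rw [Nat.succ_mul] at hx
      exact ⟨⟨x, hlt⟩, (Nat.div_eq_iff hq).2 (by dsimp only; omega), rfl⟩
  rw [← Finset.card_map, this, Nat.card_Ico, ← Nat.sub_mul]
  simp

theorem exists_isCommunityMatrix {m q : ℕ} {s : ℝ}
    {S : Matrix (Fin (m * q)) (Fin (m * q)) ℝ} (hS : S ∈ noiselessCommunity m q s) :
    ∃ cr cp : Fin (m * q) → Fin m, IsCommunityMatrix q s S cr cp := by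
  obtain ⟨ρ, τ, rfl⟩ := hS
  have hlt : ∀ i : Fin (m * q), (i : ℕ) / q < m := fun i =>
    Nat.div_lt_of_lt_mul (i.2.trans_eq (mul_comm m q))
  refine ⟨fun i => ⟨(ρ i : ℕ) / q, hlt _⟩, fun j => ⟨(τ.symm j : ℕ) / q, hlt _⟩, ?_, ?_, ?_⟩
  · intro c
    refine Eq.trans ?_ (card_filter_div_eq m q c c.2)
    exact Finset.card_bij' (fun i _ => ρ i) (fun i _ => ρ.symm i) (by simp [Fin.ext_iff])
      (by simp [Fin.ext_iff]) (by simp) (by simp)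
  · intro c
    refine Eq.trans ?_ (card_filter_div_eq m q c c.2)
    exact Finset.card_bij' (fun i _ => τ.symm i) (fun i _ => τ i) (by simp [Fin.ext_iff])
      (by simp [Fin.ext_iff]) (by simp) (by simp)
  · intro i j
    rw [Equiv.Perm.permMatrix, Equiv.Perm.permMatrix, PEquiv.mul_toMatrix_toPEquiv,
      PEquiv.toMatrix_toPEquiv_mul]
    simp [communityBlocks, Fin.ext_iff]

/-- The bids of reviewer `i` in the community model: exactly the paper in the first place receives
a bid, provided that it belongs to the community of `i`. -/
def topBids {n d m : ℕ} (cr : Fin n → Fin m) (cp : Fin d → Fin m) (i : Fin n)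
    (π : PaperOrder d) : Fin d → Bool :=
  fun j => decide ((π j : ℕ) = 0 ∧ cr i = cp j)

/-- All bids in the history are those which the community model prescribes. -/
def Faithful {n d m : ℕ} (cr : Fin n → Fin m) (cp : Fin d → Fin m) (H : History n d) : Prop :=
  ∀ a ∈ H, a.bids = topBids cr cp a.reviewer a.order

section

variable {n d m q : ℕ} {s lam : ℝ} {S : Matrix (Fin n) (Fin d) ℝ} {cr : Fin n → Fin m}
  {cp : Fin d → Fin m}

theorem Faithful.concat {H : History n d} (hH : Faithful cr cp H) (i : Fin n) (π : PaperOrder d) :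
    Faithful cr cp (H ++ [⟨i, π, topBids cr cp i π⟩]) := by
  intro a ha
  rcases List.mem_append.1 ha with ha | ha
  · exact hH a ha
  · rw [List.mem_singleton.1 ha]

namespace IsCommunityMatrix

theorem half_lt_apply_iff (hS : IsCommunityMatrix q s S cr cp) (hs : 0 < s) (i : Fin n)
    (j : Fin d) : s / 2 < S i j ↔ cr i = cp j := by
  rw [hS.apply]
  split_ifs with h <;> simp [h] <;> linarith

theorem run_cons (hS : IsCommunityMatrix q s S cr cp) (hs : 0 < s) (A : Algorithm n d)
    (i : Fin n) (l : List (Fin n)) (H : History n d) :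
    run (communityModel s lam) S A (i :: l) H = (A H i).bind fun π =>
      run (communityModel s lam) S A l (H ++ [⟨i, π, topBids cr cp i π⟩]) := by
  rw [run]
  congr 1
  funext π
  rw [independentBids_eq_pure (b := topBids cr cp i π), PMF.pure_bind]
  intro j
  simp only [communityModel, topBids, position, hS.half_lt_apply_iff hs, decide_eq_true_eq,
    Nat.add_eq_right]

/-- A property of histories that is preserved by every step of the process holds for every possible
final history. -/
theorem run_induction (hS : IsCommunityMatrix q s S cr cp) (hs : 0 < s) {A : Algorithm n d}
    {P : History n d → Prop}
    (step : ∀ H i, ∀ π ∈ (A H i).support, Faithful cr cp H →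
      (H.map Arrival.reviewer ++ [i]).Nodup → P H → P (H ++ [⟨i, π, topBids cr cp i π⟩]))
    (l : List (Fin n)) (H : History n d) (hH : Faithful cr cp H)
    (hl : (H.map Arrival.reviewer ++ l).Nodup) (hP : P H) :
    ∀ H' ∈ (run (communityModel s lam) S A l H).support,
      P H' ∧ H'.length = H.length + l.length := by
  induction l generalizing H with
  | nil =>
    intro H' hH'
    rw [run, PMF.mem_support_pure_iff] at hH'
    subst hH'
    exact ⟨hP, rfl⟩
  | cons i l ih =>
    intro H' hH'
    rw [hS.run_cons hs, PMF.mem_support_bind_iff] at hH'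
    obtain ⟨π, hπ, hH'⟩ := hH'
    have hl' : (H.map Arrival.reviewer ++ [i] ++ l).Nodup := by simpa using hl
    obtain ⟨h1, h2⟩ := ih _ (hH.concat i π) (by simpa using hl)
      (step H i π hπ hH (List.Nodup.of_append_left hl') hP) H' hH'
    refine ⟨h1, ?_⟩
    rw [h2]
    simp
    omega

end IsCommunityMatrix

/-! ### Expectations over final histories -/

theorem summable_toReal_mul {α : Type*} {p : PMF α} (hp : p.support.Finite) (f : α → ℝ) :
    Summable fun a => (p a).toReal * f a := by
  refine summable_of_hasFiniteSupport (hp.subset fun a ha h0 => ?_)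
  simp [h0] at ha

theorem tsum_toReal_mul_const {α : Type*} (p : PMF α) (C : ℝ) : ∑' a, (p a).toReal * C = C := by
  rw [tsum_mul_right, ← ENNReal.tsum_toReal_eq fun a => p.apply_ne_top a, p.tsum_coe]
  simp

theorem tsum_toReal_mul_le_tsum {α : Type*} {p : PMF α} (hp : p.support.Finite) {f g : α → ℝ}
    (h : ∀ a ∈ p.support, f a ≤ g a) :
    ∑' a, (p a).toReal * f a ≤ ∑' a, (p a).toReal * g a := by
  refine (summable_toReal_mul hp f).tsum_le_tsum (fun a => ?_) (summable_toReal_mul hp g)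
  by_cases ha : a ∈ p.support
  · exact mul_le_mul_of_nonneg_left (h a ha) ENNReal.toReal_nonneg
  · rw [PMF.mem_support_iff, not_not] at ha
    simp [ha]

theorem expectedGain_le_of_forall_support {M : BiddingModel} {σ : Equiv.Perm (Fin n)}
    {A : Algorithm n d} {C : ℝ}
    (h : ∀ H ∈ (run M S A (List.ofFn σ) []).support, gain M S H ≤ C) :
    expectedGain M S σ A ≤ C :=
  (tsum_toReal_mul_le_tsum (run_support_finite M S A _ _) h).trans_eq (tsum_toReal_mul_const _ C)

theorem le_expectedGain_of_forall_support {M : BiddingModel} {σ : Equiv.Perm (Fin n)}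
    {A : Algorithm n d} {C : ℝ}
    (h : ∀ H ∈ (run M S A (List.ofFn σ) []).support, C ≤ gain M S H) :
    C ≤ expectedGain M S σ A :=
  (tsum_toReal_mul_const _ C).symm.trans_le
    (tsum_toReal_mul_le_tsum (run_support_finite M S A _ _) h)

theorem tsum_bind_mul_eq {α β : Type*} [Fintype α] (p : PMF α) (g : α → PMF β) (f : β → ℝ)
    (hg : ∀ a, (g a).support.Finite) :
    ∑' b, ((p.bind g) b).toReal * f b = ∑ a, (p a).toReal * ∑' b, (g a b).toReal * f b := by
  simp_rw [← tsum_mul_left]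
  rw [← Summable.tsum_finsetSum fun a _ => (summable_toReal_mul (hg a) f).mul_left _]
  refine tsum_congr fun b => ?_
  rw [PMF.bind_apply, tsum_fintype, ENNReal.toReal_sum fun a _ =>
    ENNReal.mul_ne_top (p.apply_ne_top a) ((g a).apply_ne_top b), Finset.sum_mul]
  refine Finset.sum_congr rfl fun a _ => ?_
  rw [ENNReal.toReal_mul, mul_assoc]

/-! ### The gain of a single step -/

/-- The DCG discount of the (zero-based) place `k`. -/
noncomputable def discount (k : ℕ) : ℝ := 1 / Real.logb 2 ((k : ℝ) + 2)

theorem discount_antitone : Antitone discount := by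
  intro a b hab
  have h : (a : ℝ) ≤ b := by exact_mod_cast hab
  have ha : (0 : ℝ) ≤ a := a.cast_nonneg
  refine one_div_le_one_div_of_le (Real.logb_pos one_lt_two (by linarith)) ?_
  exact Real.logb_le_logb_of_le one_lt_two (by linarith) (by linarith)

theorem sum_le_sum_range_card {h : ℕ → ℝ} (hh : Antitone h) (T : Finset ℕ) :
    ∑ k ∈ T, h k ≤ ∑ k ∈ range #T, h k := by
  induction T using Finset.induction_on_max with
  | empty => simp
  | insert a T ha ih =>
    have ha' : a ∉ T := fun h => (ha a h).false
    have hcard : #T ≤ a := by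
      simpa using Finset.card_le_card (fun x hx => Finset.mem_range.2 (ha x hx) : T ⊆ range a)
    rw [Finset.sum_insert ha', Finset.card_insert_of_notMem ha', Finset.sum_range_succ, add_comm]
    exact add_le_add ih (hh hcard)


theorem bidCount_concat (H : History n d) (a : Arrival n d) (j : Fin d) :
    bidCount (H ++ [a]) j = bidCount H j + if a.bids j then 1 else 0 := by
  simp [bidCount, List.countP_append, List.countP_singleton]

/-- The gain of one step: the objective of SUPER* with zero heuristic at the ordering `π`. -/
noncomputable def stepGain (s lam : ℝ) (S : Matrix (Fin n) (Fin d) ℝ) (H : History n d)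
    (i : Fin n) (π : PaperOrder d) : ℝ :=
  ∑ j, superWeight (communityModel s lam) S (zeroHeuristic n d) H i j (π j)

/-- The sum of the discounts of the places at which `π` shows the papers of the community `c`. -/
noncomputable def communityDiscount (cp : Fin d → Fin m) (c : Fin m) (π : PaperOrder d) : ℝ :=
  ∑ j with cp j = c, discount (π j)

/-- The increase of the square-root paper-side gain when reviewer `i` is shown the ordering `π`. -/
noncomputable def paperIncrement [NeZero d] (cr : Fin n → Fin m) (cp : Fin d → Fin m)
    (H : History n d) (i : Fin n) (π : PaperOrder d) : ℝ :=
  if cr i = cp (π.symm 0) then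
    √(bidCount H (π.symm 0) + 1) - √(bidCount H (π.symm 0)) else 0

theorem communityDiscount_eq_sum_image (cp : Fin d → Fin m) (c : Fin m) (π : PaperOrder d) :
    communityDiscount cp c π = ∑ k ∈ (univ.filter fun j => cp j = c).image fun j => (π j : ℕ),
      discount k := by
  rw [communityDiscount, Finset.sum_image]
  intro j _ k _ hjk
  exact π.injective (Fin.ext hjk)

theorem card_image_place (T : Finset (Fin d)) (π : PaperOrder d) :
    #(T.image fun j => (π j : ℕ)) = #T :=
  Finset.card_image_of_injective _ fun _ _ h => π.injective (Fin.ext h)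

theorem paperIncrement_le_one [NeZero d] (H : History n d) (i : Fin n) (π : PaperOrder d) :
    paperIncrement cr cp H i π ≤ if cr i = cp (π.symm 0) then 1 else 0 := by
  rw [paperIncrement]
  split_ifs
  · rw [sub_le_iff_le_add, Real.sqrt_le_iff]
    have h := Real.sq_sqrt (Nat.cast_nonneg (α := ℝ) (bidCount H (π.symm 0)))
    have h' := Real.sqrt_nonneg (bidCount H (π.symm 0) : ℝ)
    exact ⟨by linarith, by linarith [add_sq 1 √(bidCount H (π.symm 0) : ℝ)]⟩
  · exact le_rfl

namespace IsCommunityMatrix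

theorem communityDiscount_le (hS : IsCommunityMatrix q s S cr cp) (c : Fin m)
    (π : PaperOrder d) : communityDiscount cp c π ≤ ∑ k ∈ range q, discount k := by
  rw [communityDiscount_eq_sum_image]
  refine (sum_le_sum_range_card discount_antitone _).trans_eq ?_
  rw [card_image_place, hS.card_papers]

theorem stepGain_eq [NeZero d] (hS : IsCommunityMatrix q s S cr cp) (hs : 0 < s) (H : History n d)
    (i : Fin n) (π : PaperOrder d) :
    stepGain s lam S H i π =
      lam * ((2 ^ s - 1) * communityDiscount cp (cr i) π) + paperIncrement cr cp H i π := by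
  have hpos : ∀ j, ((π j : ℕ) + 1 = 1 ∧ s / 2 < S i j) ↔ (j = π.symm 0 ∧ cr i = cp j) := by
    intro j
    rw [hS.half_lt_apply_iff hs, Equiv.eq_symm_apply, Fin.ext_iff]
    simp
  simp only [stepGain, superWeight, Finset.sum_add_distrib]
  congr 1
  · rw [communityDiscount, Finset.mul_sum, Finset.mul_sum, Finset.sum_filter]
    refine Finset.sum_congr rfl fun j _ => ?_
    simp only [communityModel, hS.apply, eq_comm (a := cp j), discount]
    split_ifs
    · push_cast
      rw [add_assoc, one_add_one_eq_two]
      ring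
    · simp
  · rw [Finset.sum_eq_single (π.symm 0)]
    · have h := hpos (π.symm 0)
      simp only [true_and] at h
      simp only [communityModel, h, zeroHeuristic, add_zero, paperIncrement]
      split_ifs <;> simp
    · intro j _ hj
      have h := hpos j
      simp only [hj, false_and, iff_false] at h
      simp only [communityModel, h, if_false, Set.Icc.coe_zero, zero_mul]
    · simp

theorem gain_concat (hS : IsCommunityMatrix q s S cr cp) (hs : 0 < s) (H : History n d)
    (i : Fin n) (π : PaperOrder d) :
    gain (communityModel s lam) S (H ++ [⟨i, π, topBids cr cp i π⟩]) =
      gain (communityModel s lam) S H + stepGain s lam S H i π := by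
  have hb : ∀ j, ((π j : ℕ) + 1 = 1 ∧ s / 2 < S i j) ↔ topBids cr cp i π j = true := by
    intro j
    rw [hS.half_lt_apply_iff hs]
    simp [topBids]
  simp only [gain, stepGain, superWeight, List.map_append, List.sum_append, List.map_singleton,
    List.sum_singleton, bidCount_concat, Finset.sum_add_distrib]
  have h1 : ∀ j, (communityModel s lam).paperGain
        ((bidCount H j + if topBids cr cp i π j then 1 else 0 : ℕ) : ℝ) =
      (communityModel s lam).paperGain (bidCount H j) +
      ((communityModel s lam).bidProb ((π j : ℕ) + 1) (S i j) : ℝ) *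
        ((communityModel s lam).paperGain (bidCount H j + zeroHeuristic n d H i j + 1) -
          (communityModel s lam).paperGain (bidCount H j + zeroHeuristic n d H i j)) := by
    intro j
    simp only [communityModel, hb, zeroHeuristic]
    split_ifs <;> simp
  simp only [h1, Finset.sum_add_distrib, mul_add, Finset.mul_sum]
  rw [show (communityModel s lam).tradeoff = lam from rfl]
  simp only [position]
  ring

theorem stepGain_le [NeZero d] (hS : IsCommunityMatrix q s S cr cp) (hs : 0 < s) (hlam : 0 ≤ lam)
    (H : History n d) (i : Fin n) (π : PaperOrder d) :
    stepGain s lam S H i π ≤ lam * ((2 ^ s - 1) * ∑ k ∈ range q, discount k) +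
      if cr i = cp (π.symm 0) then 1 else 0 := by
  rw [hS.stepGain_eq hs]
  have h2 : (0 : ℝ) ≤ 2 ^ s - 1 := sub_nonneg.2 (Real.one_le_rpow one_le_two hs.le)
  gcongr
  · exact hS.communityDiscount_le _ _
  · exact paperIncrement_le_one H i π

end IsCommunityMatrix

/-! ### Optimality of SIM and SUPER* -/

/-- The largest possible gain of a single step. -/
noncomputable def maxStepGain (q : ℕ) (s lam : ℝ) : ℝ :=
  lam * ((2 ^ s - 1) * ∑ k ∈ range q, discount k) + 1

theorem sum_bidCount_le_countP {H : History n d} (T : Finset (Fin d)) (p : Arrival n d → Bool)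
    (h : ∀ a ∈ H, #{j ∈ T | a.bids j} ≤ if p a then 1 else 0) :
    ∑ j ∈ T, bidCount H j ≤ H.countP p := by
  induction H with
  | nil => simp [bidCount]
  | cons a H ih =>
    have ha := h a List.mem_cons_self
    have ih' := ih fun b hb => h b (List.mem_cons_of_mem a hb)
    rw [Finset.card_filter] at ha
    simp only [bidCount, List.countP_cons, Finset.sum_add_distrib] at ih' ⊢
    omega

theorem Faithful.sum_community_bidCount_le {H : History n d} (hH : Faithful cr cp H) (c : Fin m) :
    ∑ j with cp j = c, bidCount H j ≤ H.countP fun a => cr a.reviewer = c := by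
  refine sum_bidCount_le_countP _ _ fun a ha => ?_
  rw [hH a ha]
  split_ifs with hc
  · refine Finset.card_le_one.2 fun j hj k hk => ?_
    simp only [topBids, Finset.mem_filter, decide_eq_true_eq] at hj hk
    exact a.order.injective (Fin.ext (hj.2.1.trans hk.2.1.symm))
  · rw [Nat.le_zero, Finset.card_eq_zero, Finset.filter_eq_empty_iff]
    intro j hj
    simp only [Finset.mem_filter, Finset.mem_univ, true_and] at hj
    simp only [topBids, decide_eq_true_eq, not_and] at hc ⊢
    exact fun _ h => hc (h.trans hj)

theorem Faithful.sum_bidCount_le_length {H : History n d} (hH : Faithful cr cp H) :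
    ∑ j, bidCount H j ≤ H.length := by
  refine (sum_bidCount_le_countP _ (fun _ => true) fun a ha => ?_).trans List.countP_le_length
  rw [hH a ha, if_pos rfl]
  refine Finset.card_le_one.2 fun j hj k hk => ?_
  simp only [topBids, Finset.mem_filter, decide_eq_true_eq] at hj hk
  exact a.order.injective (Fin.ext (hj.2.1.trans hk.2.1.symm))

namespace IsCommunityMatrix

/-- There are as many reviewers as papers in each community, and each reviewer bids at most once, so
an arriving reviewer always finds a paper without bids in the own community. -/
theorem exists_bidCount_eq_zero (hS : IsCommunityMatrix q s S cr cp) {H : History n d}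
    (hH : Faithful cr cp H) {i : Fin n} (hi : (H.map Arrival.reviewer ++ [i]).Nodup) :
    ∃ j, cp j = cr i ∧ bidCount H j = 0 := by
  by_contra! hcon
  have h1 : q ≤ ∑ j with cp j = cr i, bidCount H j := by
    rw [← hS.card_papers (cr i), Finset.card_eq_sum_ones]
    refine Finset.sum_le_sum fun j hj => Nat.one_le_iff_ne_zero.2 (hcon j ?_)
    simpa using hj
  have h2 := hH.sum_community_bidCount_le (cr i)
  have h3 : (H.countP fun a => cr a.reviewer = cr i) + 1 ≤ q := by
    have hnd := hi.filter fun k => decide (cr k = cr i)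
    calc (H.countP fun a => cr a.reviewer = cr i) + 1
        = ((H.map Arrival.reviewer ++ [i]).filter fun k => cr k = cr i).length := by
          rw [← List.countP_eq_length_filter]
          simp [List.countP_append, List.countP_map, Function.comp_def]
      _ = #((H.map Arrival.reviewer ++ [i]).filter fun k => cr k = cr i).toFinset :=
          (List.toFinset_card_of_nodup hnd).symm
      _ ≤ #{k | cr k = cr i} := Finset.card_le_card fun k hk => by
          simp only [List.mem_toFinset, List.mem_filter, decide_eq_true_eq] at hk
          simpa using hk.2
      _ = q := hS.card_reviewers _
  omega

theorem communityDiscount_eq_of_lt (hS : IsCommunityMatrix q s S cr cp) {c : Fin m}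
    {π : PaperOrder d} (h : ∀ j k, cp j = c → cp k ≠ c → π j < π k) :
    communityDiscount cp c π = ∑ k ∈ range q, discount k := by
  rw [communityDiscount_eq_sum_image]
  congr 1
  refine Finset.eq_of_subset_of_card_le (fun x hx => ?_) ?_
  · simp only [Finset.mem_image, Finset.mem_filter, Finset.mem_univ, true_and] at hx
    obtain ⟨j, hj, rfl⟩ := hx
    -- all papers that are shown up to `j` belong to the community
    have hsub : Finset.Iic (π j) ⊆ (univ.filter fun j => cp j = c).image π := by
      intro y hy
      refine Finset.mem_image.2 ⟨π.symm y, ?_, by simp⟩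
      by_contra hcon
      have := h j (π.symm y) hj (by simpa using hcon)
      rw [Equiv.apply_symm_apply] at this
      exact absurd (Finset.mem_Iic.1 hy) (not_le.2 this)
    have hcard := Finset.card_le_card hsub
    rw [Finset.card_image_of_injective _ π.injective, hS.card_papers, Fin.card_Iic] at hcard
    exact Finset.mem_range.2 hcard
  · rw [card_image_place, hS.card_papers, Finset.card_range]

theorem stepGain_of_mem_sortedOrderings [NeZero d] (hS : IsCommunityMatrix q s S cr cp)
    (hs : 0 < s) {H : History n d} (hH : Faithful cr cp H) {i : Fin n}
    (hi : (H.map Arrival.reviewer ++ [i]).Nodup) {π : PaperOrder d}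
    (hπ : π ∈ sortedOrderings
      fun j => (toLex (OrderDual.toDual (S i j), bidCount H j) : ℝᵒᵈ ×ₗ ℕ)) :
    stepGain s lam S H i π = maxStepGain q s lam := by
  simp only [sortedOrderings, Finset.mem_filter, Finset.mem_univ, true_and, Prod.Lex.toLex_lt_toLex,
    OrderDual.toDual_lt_toDual, OrderDual.toDual_inj] at hπ
  have hlt : ∀ j k, cp j = cr i → cp k ≠ cr i → π j < π k := fun j k hj hk =>
    hπ j k (Or.inl (by rw [hS.apply, hS.apply, if_pos hj.symm, if_neg hk.symm]; exact hs))
  obtain ⟨j, hj, hj0⟩ := hS.exists_bidCount_eq_zero hH hi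
  have htop : cp (π.symm 0) = cr i := by
    by_contra hcon
    have := hlt j _ hj hcon
    simp at this
  have hzero : bidCount H (π.symm 0) = 0 := by
    by_contra hcon
    have := hπ j (π.symm 0) (Or.inr ⟨by rw [hS.apply, hS.apply, if_pos hj.symm, if_pos htop.symm],
      by rw [hj0]; exact Nat.pos_of_ne_zero hcon⟩)
    simp at this
  rw [hS.stepGain_eq hs, hS.communityDiscount_eq_of_lt hlt, paperIncrement, if_pos htop.symm, hzero,
    maxStepGain]
  simp

theorem expectedGain_le [NeZero d] (hS : IsCommunityMatrix q s S cr cp) (hs : 0 < s)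
    (hlam : 0 ≤ lam) (σ : Equiv.Perm (Fin n)) (A : Algorithm n d) :
    expectedGain (communityModel s lam) S σ A ≤ n * maxStepGain q s lam := by
  refine expectedGain_le_of_forall_support fun H hH => ?_
  have h := hS.run_induction hs (A := A)
    (P := fun H => gain (communityModel s lam) S H ≤ H.length * maxStepGain q s lam)
    (fun H i π _ _ _ hP => by
      rw [hS.gain_concat hs]
      have h1 := hS.stepGain_le hs hlam H i π
      have h2 : (if cr i = cp (π.symm 0) then (1 : ℝ) else 0) ≤ 1 := by split_ifs <;> simp
      simp only [List.length_append, List.length_singleton, Nat.cast_add, Nat.cast_one, add_mul]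
      rw [maxStepGain] at hP ⊢
      linarith)
    (List.ofFn σ) [] (by simp [Faithful]) (by simpa using List.nodup_ofFn.2 σ.injective)
    (by simp [gain, bidCount, communityModel]) H hH
  simpa [h.2] using h.1

/-- An algorithm is optimal if each of its steps has the largest possible gain. -/
theorem le_expectedGain_of_step [NeZero d] (hS : IsCommunityMatrix q s S cr cp) (hs : 0 < s)
    (σ : Equiv.Perm (Fin n)) {A : Algorithm n d}
    (hA : ∀ H i, ∀ π ∈ (A H i).support, Faithful cr cp H →
      (H.map Arrival.reviewer ++ [i]).Nodup → maxStepGain q s lam ≤ stepGain s lam S H i π) :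
    n * maxStepGain q s lam ≤ expectedGain (communityModel s lam) S σ A := by
  refine le_expectedGain_of_forall_support fun H hH => ?_
  have h := hS.run_induction hs (A := A)
    (P := fun H => H.length * maxStepGain q s lam ≤ gain (communityModel s lam) S H)
    (fun H i π hπ hF hnd hP => by
      rw [hS.gain_concat hs]
      have h1 := hA H i π hπ hF hnd
      simp only [List.length_append, List.length_singleton, Nat.cast_add, Nat.cast_one, add_mul]
      linarith)
    (List.ofFn σ) [] (by simp [Faithful]) (by simpa using List.nodup_ofFn.2 σ.injective)
    (by simp [gain, bidCount, communityModel]) H hH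
  simpa [h.2] using h.1

theorem le_expectedGain_simAlg [NeZero d] (hS : IsCommunityMatrix q s S cr cp) (hs : 0 < s)
    (σ : Equiv.Perm (Fin n)) :
    n * maxStepGain q s lam ≤ expectedGain (communityModel s lam) S σ (simAlg S) := by
  refine hS.le_expectedGain_of_step hs σ fun H i π hπ hF hnd => ?_
  rw [simAlg, PMF.mem_support_uniformOfFinset_iff] at hπ
  exact (hS.stepGain_of_mem_sortedOrderings hs hF hnd hπ).ge

end IsCommunityMatrix

theorem IsPaperOrder.sum_le {w : Fin d → Fin d → ℝ} {π : PaperOrder d} (hπ : IsPaperOrder w π)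
    (τ : PaperOrder d) : ∑ j, w j (τ j) ≤ ∑ j, w j (π j) := by
  obtain ⟨x, ⟨hx, hmax⟩, hx1⟩ := hπ
  have hx0 : ∀ j k, k ≠ π j → x j k = 0 := by
    intro j k hk
    have hrow := sum_row_of_mem_doublyStochastic hx j
    rw [← Finset.add_sum_erase _ _ (Finset.mem_univ (π j)), hx1, add_eq_left,
      Finset.sum_eq_zero_iff_of_nonneg fun k _ => nonneg_of_mem_doublyStochastic hx] at hrow
    exact hrow k (by simpa using hk)
  convert hmax (τ.permMatrix ℝ) permMatrix_mem_doublyStochastic using 1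
  · refine Finset.sum_congr rfl fun j _ => ?_
    simp [Equiv.Perm.permMatrix, PEquiv.toMatrix_apply]
  · refine Finset.sum_congr rfl fun j _ => ?_
    rw [Finset.sum_eq_single (π j) (fun k _ hk => by rw [hx0 j k hk, mul_zero]) (by simp), hx1,
      mul_one]

theorem IsCommunityMatrix.le_expectedGain_superStar [NeZero d]
    (hS : IsCommunityMatrix q s S cr cp) (hs : 0 < s) (σ : Equiv.Perm (Fin n)) {A : Algorithm n d}
    (hA : IsSuperStar (communityModel s lam) S (zeroHeuristic n d) A) :
    n * maxStepGain q s lam ≤ expectedGain (communityModel s lam) S σ A := by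
  refine hS.le_expectedGain_of_step hs σ fun H i π hπ hF hnd => ?_
  obtain ⟨τ, hτ⟩ := sortedOrderings_nonempty
    fun j => (toLex (OrderDual.toDual (S i j), bidCount H j) : ℝᵒᵈ ×ₗ ℕ)
  rw [← hS.stepGain_of_mem_sortedOrderings (lam := lam) hs hF hnd hτ]
  exact (hA H i π hπ).sum_le τ

/-! ### The loss of RAND -/

/-- Under a uniformly random ordering, the paper in the first place is uniformly distributed. -/
theorem sum_perm_symm_zero [NeZero d] (g : Fin d → ℝ) :
    d * ∑ π : PaperOrder d, g (π.symm 0) = Fintype.card (PaperOrder d) * ∑ j, g j := by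
  have h : ∀ r : Fin d, ∑ π : PaperOrder d, g (π.symm 0) = ∑ π : PaperOrder d, g (r + π.symm 0) :=
    fun r => (Fintype.sum_equiv (Equiv.mulRight (Equiv.addLeft r).symm) _ _ fun π => rfl).symm
  calc d * ∑ π : PaperOrder d, g (π.symm 0) = ∑ _r : Fin d, ∑ π : PaperOrder d, g (π.symm 0) := by
        simp
    _ = ∑ r : Fin d, ∑ π : PaperOrder d, g (r + π.symm 0) := Finset.sum_congr rfl fun r _ => h r
    _ = ∑ π : PaperOrder d, ∑ r : Fin d, g (r + π.symm 0) := Finset.sum_comm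
    _ = ∑ _π : PaperOrder d, ∑ j, g j := Finset.sum_congr rfl fun π _ =>
        Fintype.sum_equiv (Equiv.addRight (π.symm 0)) _ _ fun r => rfl
    _ = Fintype.card (PaperOrder d) * ∑ j, g j := by simp

namespace IsCommunityMatrix

theorem expectedGain_randAlg_le [NeZero d] (hS : IsCommunityMatrix q s S cr cp) (hs : 0 < s)
    (hlam : 0 ≤ lam) (hq : 2 * q ≤ d) (σ : Equiv.Perm (Fin n)) :
    expectedGain (communityModel s lam) S σ (randAlg n d) ≤ n * (maxStepGain q s lam - 1 / 2) := by
  set N : ℝ := (Fintype.card (PaperOrder d) : ℝ) with hN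
  have hN0 : 0 < N := by rw [hN]; exact_mod_cast Fintype.card_pos
  have hd0 : (0 : ℝ) < d := by exact_mod_cast NeZero.pos d
  have hprob : ∀ (H : History n d) i (π : PaperOrder d), (randAlg n d H i π).toReal = N⁻¹ := by
    intro H i π
    simp [randAlg, hN]
  have htop : ∀ i, ∑ π : PaperOrder d, N⁻¹ * (if cr i = cp (π.symm 0) then (1 : ℝ) else 0) ≤
      1 / 2 := by
    intro i
    have h := sum_perm_symm_zero (fun j => if cr i = cp j then (1 : ℝ) else 0)
    have hcard : ∑ j, (if cr i = cp j then (1 : ℝ) else 0) = q := by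
      rw [Finset.sum_boole, ← hS.card_papers (cr i)]
      simp only [eq_comm]
    rw [hcard, ← hN] at h
    have hq' : (2 : ℝ) * q ≤ d := by exact_mod_cast hq
    rw [← Finset.mul_sum, inv_mul_le_iff₀ hN0]
    nlinarith
  have hsum1 : ∑ _π : PaperOrder d, N⁻¹ = 1 := by
    rw [Finset.sum_const, Finset.card_univ, nsmul_eq_mul, ← hN, mul_inv_cancel₀ hN0.ne']
  have key : ∀ (l : List (Fin n)) (H : History n d),
      ∑' H', (run (communityModel s lam) S (randAlg n d) l H H').toReal *
        gain (communityModel s lam) S H' ≤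
      gain (communityModel s lam) S H + l.length * (maxStepGain q s lam - 1 / 2) := by
    intro l
    induction l with
    | nil =>
      intro H
      rw [tsum_eq_single H fun H' hH' => by simp [run, hH']]
      simp [run]
    | cons i l ih =>
      intro H
      rw [hS.run_cons hs, tsum_bind_mul_eq _ _ _ fun π => run_support_finite _ _ _ _ _]
      simp only [hprob]
      calc _ ≤ ∑ π : PaperOrder d, N⁻¹ * ((gain (communityModel s lam) S H +
              l.length * (maxStepGain q s lam - 1 / 2) + (maxStepGain q s lam - 1)) +
              (if cr i = cp (π.symm 0) then (1 : ℝ) else 0)) := by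
            refine Finset.sum_le_sum fun π _ => mul_le_mul_of_nonneg_left ?_ (inv_pos.2 hN0).le
            refine (ih _).trans ?_
            rw [hS.gain_concat hs]
            have := hS.stepGain_le hs hlam H i π
            rw [maxStepGain]
            linarith
        _ = (gain (communityModel s lam) S H +
              l.length * (maxStepGain q s lam - 1 / 2) + (maxStepGain q s lam - 1)) +
            ∑ π : PaperOrder d, N⁻¹ * (if cr i = cp (π.symm 0) then (1 : ℝ) else 0) := by
            simp only [mul_add (N⁻¹), Finset.sum_add_distrib, ← Finset.sum_mul, hsum1, one_mul]
        _ ≤ _ := by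
            have := htop i
            rw [List.length_cons, Nat.cast_succ]
            linarith
  have h := key (List.ofFn σ) []
  simpa [expectedGain, gain, bidCount, communityModel] using h

end IsCommunityMatrix

/-! ### The loss of BID -/

/-- The communities with a paper that has already received a bid. -/
def touchedCommunities (cp : Fin d → Fin m) (H : History n d) : Finset (Fin m) :=
  univ.filter fun c => ∃ j, cp j = c ∧ 0 < bidCount H j

theorem touchedCommunities_subset_concat (H : History n d) (a : Arrival n d) :
    touchedCommunities cp H ⊆ touchedCommunities cp (H ++ [a]) := by
  intro c hc
  simp only [touchedCommunities, Finset.mem_filter, Finset.mem_univ, true_and] at hc ⊢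
  obtain ⟨j, hj, hpos⟩ := hc
  exact ⟨j, hj, by rw [bidCount_concat]; omega⟩

/-- The reviewer-side loss (up to the factor `2 ^ s - 1`) of an ordering that shows a paper of the
community of the reviewer at place `q + ⌊q / 8⌋` (counted from zero) or later. -/
noncomputable def displacementLoss (q : ℕ) : ℝ := discount (q - 1) - discount (q + q / 8)

namespace IsCommunityMatrix

theorem communityDiscount_le_of_displaced (hS : IsCommunityMatrix q s S cr cp) {c : Fin m}
    {π : PaperOrder d} {j : Fin d} (hj : cp j = c) (hπ : q + q / 8 ≤ π j) :
    communityDiscount cp c π ≤ ∑ k ∈ range q, discount k - displacementLoss q := by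
  have hmem : j ∈ univ.filter fun j => cp j = c := by simpa using hj
  have hcard : #((univ.filter fun j => cp j = c).erase j) = q - 1 := by
    rw [Finset.card_erase_of_mem hmem, hS.card_papers]
  have hq : q = q - 1 + 1 := by
    have : 0 < q := by rw [← hS.card_papers c]; exact Finset.card_pos.2 ⟨j, hmem⟩
    omega
  have h1 : ∑ k ∈ (univ.filter fun j => cp j = c).erase j, discount (π k) ≤
      ∑ k ∈ range (q - 1), discount k := by
    rw [← hcard, ← card_image_place _ π]
    refine le_trans (le_of_eq ?_) (sum_le_sum_range_card discount_antitone _)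
    rw [Finset.sum_image]
    exact fun _ _ _ _ h => π.injective (Fin.ext h)
  have h2 : ∑ k ∈ range q, discount k = ∑ k ∈ range (q - 1), discount k + discount (q - 1) := by
    conv_lhs => rw [hq]
    rw [Finset.sum_range_succ]
  rw [communityDiscount, ← Finset.add_sum_erase _ _ hmem, displacementLoss, h2]
  linarith [discount_antitone hπ]

/-- Early in the process, many papers have no bid, and BID shows each of them before any paper with
a bid. -/
theorem stepGain_bid_le [NeZero d] (hS : IsCommunityMatrix q s S cr cp) (hs : 0 < s)
    (hlam : 0 ≤ lam) {H : History n d} (hH : Faithful cr cp H)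
    (hlen : H.length + (q + q / 8) ≤ d) {i : Fin n} {π : PaperOrder d}
    (hπ : ∀ j k, bidCount H j < bidCount H k → π j < π k)
    (hi : cr i ∈ touchedCommunities cp H) :
    stepGain s lam S H i π ≤
      maxStepGain q s lam - lam * ((2 ^ s - 1) * displacementLoss q) := by
  simp only [touchedCommunities, Finset.mem_filter, Finset.mem_univ, true_and] at hi
  obtain ⟨j, hj, hpos⟩ := hi
  have hplace : q + q / 8 ≤ π j := by
    have h1 : #{k | bidCount H k ≠ 0} ≤ H.length := by
      refine le_trans ?_ hH.sum_bidCount_le_length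
      rw [Finset.card_eq_sum_ones, Finset.sum_filter]
      refine Finset.sum_le_sum fun k _ => ?_
      split_ifs <;> omega
    have h2 : #{k | bidCount H k = 0} ≤ π j := by
      rw [← Fin.card_Iio, ← Finset.card_image_of_injective _ π.injective]
      refine Finset.card_le_card fun y hy => ?_
      obtain ⟨k, hk, rfl⟩ := Finset.mem_image.1 hy
      simp only [Finset.mem_filter, Finset.mem_univ, true_and] at hk
      exact Finset.mem_Iio.2 (hπ k j (by omega))
    have h3 := Finset.card_filter_add_card_filter_not (s := (univ : Finset (Fin d)))
      fun k => bidCount H k = 0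
    rw [Finset.card_univ, Fintype.card_fin] at h3
    simp only [ne_eq] at h1
    omega
  have h2s : (0 : ℝ) ≤ 2 ^ s - 1 := sub_nonneg.2 (Real.one_le_rpow one_le_two hs.le)
  have h4 := mul_le_mul_of_nonneg_left (mul_le_mul_of_nonneg_left
    (hS.communityDiscount_le_of_displaced hj hplace) h2s) hlam
  have h5 := paperIncrement_le_one (cr := cr) (cp := cp) H i π
  have h6 : (if cr i = cp (π.symm 0) then (1 : ℝ) else 0) ≤ 1 := by split_ifs <;> simp
  rw [hS.stepGain_eq hs, maxStepGain]
  rw [mul_sub, mul_sub] at h4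
  linarith

/-- If no paper in the community of the arriving reviewer has a bid, then BID shows one of them in
the first place, so it receives a bid. -/
theorem card_touchedCommunities_lt [NeZero d] (hS : IsCommunityMatrix q s S cr cp) (hs : 0 < s)
    (hq : 0 < q) {H : History n d} {i : Fin n} {π : PaperOrder d}
    (hπ : π ∈ sortedOrderings
      fun j => (toLex (bidCount H j, OrderDual.toDual (S i j)) : ℕ ×ₗ ℝᵒᵈ))
    (hi : cr i ∉ touchedCommunities cp H) :
    #(touchedCommunities cp H) + 1 ≤
      #(touchedCommunities cp (H ++ [⟨i, π, topBids cr cp i π⟩])) := by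
  simp only [sortedOrderings, Finset.mem_filter, Finset.mem_univ, true_and, Prod.Lex.toLex_lt_toLex,
    OrderDual.toDual_lt_toDual] at hπ
  have hzero : ∀ j, cp j = cr i → bidCount H j = 0 := by
    intro j hj
    by_contra hcon
    refine hi ?_
    simp only [touchedCommunities, Finset.mem_filter, Finset.mem_univ, true_and]
    exact ⟨j, hj, Nat.pos_of_ne_zero hcon⟩
  obtain ⟨j, hj⟩ : ∃ j, cp j = cr i := by
    have := hS.card_papers (cr i)
    obtain ⟨j, hj⟩ := Finset.card_pos.1 (this ▸ hq)
    exact ⟨j, by simpa using hj⟩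
  have htop : cp (π.symm 0) = cr i := by
    by_contra hcon
    have hlt : π j < π (π.symm 0) := by
      refine hπ j (π.symm 0) ?_
      rcases Nat.eq_zero_or_pos (bidCount H (π.symm 0)) with h0 | h0
      · refine Or.inr ⟨by rw [hzero j hj, h0], ?_⟩
        rw [hS.apply, hS.apply, if_pos hj.symm, if_neg (Ne.symm hcon)]
        exact hs
      · exact Or.inl (by rwa [hzero j hj])
    simp at hlt
  rw [← Finset.card_insert_of_notMem hi]
  refine Finset.card_le_card (Finset.insert_subset ?_ (touchedCommunities_subset_concat H _))
  simp only [touchedCommunities, Finset.mem_filter, Finset.mem_univ, true_and]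
  refine ⟨π.symm 0, htop, ?_⟩
  rw [bidCount_concat]
  simp [topBids, htop]

theorem expectedGain_bidAlg_le [NeZero d] (hS : IsCommunityMatrix q s S cr cp) (hs : 0 < s)
    (hlam : 0 ≤ lam) (hq : 0 < q) {T : ℕ} (hT : T + (q + q / 8) ≤ d + 1) (hTn : T ≤ n)
    (σ : Equiv.Perm (Fin n)) :
    expectedGain (communityModel s lam) S σ (bidAlg S) ≤
      n * maxStepGain q s lam - lam * ((2 ^ s - 1) * displacementLoss q) * (T - m) := by
  have h2s : (0 : ℝ) ≤ 2 ^ s - 1 := sub_nonneg.2 (Real.one_le_rpow one_le_two hs.le)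
  have hloss : 0 ≤ lam * ((2 ^ s - 1) * displacementLoss q) :=
    mul_nonneg hlam (mul_nonneg h2s (sub_nonneg.2 (discount_antitone (by omega))))
  set δ := lam * ((2 ^ s - 1) * displacementLoss q)
  refine expectedGain_le_of_forall_support fun H hH => ?_
  -- each of the first `T` steps loses at least `δ`, unless it touches a new community
  have h := hS.run_induction hs (A := bidAlg S)
    (P := fun H => gain (communityModel s lam) S H + δ * (min H.length T : ℕ) ≤
      H.length * maxStepGain q s lam + δ * #(touchedCommunities cp H))
    (fun H i π hπ hF _ hP => by
      rw [hS.gain_concat hs]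
      rw [bidAlg, PMF.mem_support_uniformOfFinset_iff] at hπ
      have h1 := hS.stepGain_le hs hlam H i π
      have h2 : (if cr i = cp (π.symm 0) then (1 : ℝ) else 0) ≤ 1 := by split_ifs <;> simp
      have h3 : stepGain s lam S H i π ≤ maxStepGain q s lam := by rw [maxStepGain]; linarith
      have hmono : δ * #(touchedCommunities cp H) ≤
          δ * #(touchedCommunities cp (H ++ [⟨i, π, topBids cr cp i π⟩])) := by
        have := Finset.card_le_card
          (touchedCommunities_subset_concat (cp := cp) H ⟨i, π, topBids cr cp i π⟩)
        gcongr
      simp only [List.length_append, List.length_singleton]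
      rcases le_or_gt T H.length with hTl | hTl
      · rw [min_eq_right hTl] at hP
        rw [min_eq_right (by omega)]
        push_cast
        linarith
      · rw [min_eq_left hTl.le] at hP
        rw [min_eq_left (by omega)]
        push_cast
        by_cases hi : cr i ∈ touchedCommunities cp H
        · have hπ' : ∀ j k, bidCount H j < bidCount H k → π j < π k := by
            intro j k hjk
            simp only [sortedOrderings, Finset.mem_filter, Finset.mem_univ, true_and] at hπ
            exact hπ j k (Prod.Lex.toLex_lt_toLex.2 (Or.inl hjk))
          have h4 := hS.stepGain_bid_le hs hlam hF (by omega) hπ' hi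
          linarith
        · have h4 := hS.card_touchedCommunities_lt hs hq hπ hi
          have h5 : δ * (#(touchedCommunities cp H) + 1) ≤
              δ * #(touchedCommunities cp (H ++ [⟨i, π, topBids cr cp i π⟩])) :=
            mul_le_mul_of_nonneg_left (by exact_mod_cast h4) hloss
          linarith)
    (List.ofFn σ) [] (by simp [Faithful]) (by simpa using List.nodup_ofFn.2 σ.injective)
    (by simpa [gain, bidCount, communityModel] using mul_nonneg hloss (Nat.cast_nonneg _)) H hH
  obtain ⟨h, hlen⟩ := h
  simp only [List.length_nil, List.length_ofFn, zero_add] at hlen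
  rw [hlen, min_eq_right hTn] at h
  have hcard : (#(touchedCommunities cp H) : ℝ) ≤ m := by
    exact_mod_cast (Finset.card_le_univ _).trans_eq (Fintype.card_fin m)
  have := mul_le_mul_of_nonneg_left hcard hloss
  rw [mul_sub]
  linarith

end IsCommunityMatrix

theorem le_displacementLoss (hq : 2 ≤ q) (hd : 2 * q ≤ d) :
    1 / 9 / Real.logb 2 d ^ 2 ≤ displacementLoss q := by
  have hq' : (2 : ℝ) ≤ q := by exact_mod_cast hq
  have hd' : (2 : ℝ) * q ≤ d := by exact_mod_cast hd
  set x : ℝ := (q : ℝ) + 1 with hx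
  set y : ℝ := ((q + q / 8 : ℕ) : ℝ) + 2 with hy
  have hxy : 9 / 8 * x ≤ y := by
    have : 9 * (q + 1) ≤ 8 * ((q + q / 8) + 2) := by omega
    have : (9 : ℝ) * (q + 1) ≤ 8 * (((q + q / 8 : ℕ) : ℝ) + 2) := by exact_mod_cast this
    linarith
  have hyd : y ≤ d := by
    have : q + q / 8 + 2 ≤ d := by omega
    rw [hy]
    exact_mod_cast this
  have hx1 : 1 < x := by linarith
  have hlx : 0 < Real.logb 2 x := Real.logb_pos one_lt_two hx1
  have hly : 0 < Real.logb 2 y := Real.logb_pos one_lt_two (by linarith)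
  have hlxy : Real.logb 2 x ≤ Real.logb 2 y :=
    Real.logb_le_logb_of_le one_lt_two (by linarith) (by linarith)
  have hlyd : Real.logb 2 y ≤ Real.logb 2 d :=
    Real.logb_le_logb_of_le one_lt_two (by linarith) hyd
  have hdiff : 1 / 9 ≤ Real.logb 2 y - Real.logb 2 x := by
    rw [← Real.logb_div (by linarith) (by linarith), Real.logb]
    have h1 : 9 / 8 ≤ y / x := by rwa [le_div_iff₀ (by linarith)]
    have h2 : (1 : ℝ) / 9 ≤ Real.log (y / x) := by
      have h3 := Real.one_sub_inv_le_log_of_pos (show (0 : ℝ) < 9 / 8 by norm_num)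
      have h4 := Real.log_le_log (by norm_num) h1
      norm_num at h3
      linarith
    have h5 : Real.log 2 ≤ 1 := by linarith [Real.log_two_lt_d9]
    rw [le_div_iff₀ (Real.log_pos one_lt_two)]
    linarith
  have heq : displacementLoss q = (Real.logb 2 y - Real.logb 2 x) /
      (Real.logb 2 x * Real.logb 2 y) := by
    have : ((q - 1 : ℕ) : ℝ) + 2 = x := by
      rw [Nat.cast_sub (by omega), hx]
      push_cast
      ring
    rw [displacementLoss, discount, discount, this, ← hy]
    field_simp
  have hlxd := hlxy.trans hlyd
  have hld := hlx.le.trans hlxd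
  rw [heq, sq]
  gcongr

end

end

theorem theorem3 :
    (∀ m q : ℕ, 2 ≤ m → 2 ≤ q → ∀ lam : ℝ, 0 ≤ lam → ∀ s : ℝ, 0.01 ≤ s → s ≤ 1 →
      ∀ S ∈ noiselessCommunity m q s, ∀ σ : Equiv.Perm (Fin (m * q)),
        (∀ A : Algorithm (m * q) (m * q),
          IsSuperStar (communityModel s lam) S (zeroHeuristic (m * q) (m * q)) A →
            IsOptimal (communityModel s lam) S σ A) ∧
        IsOptimal (communityModel s lam) S σ (simAlg S)) ∧
    ∃ c : ℝ, 0 < c ∧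
      ∀ m q : ℕ, 2 ≤ m → 2 ≤ q → ∀ lam : ℝ, 0 ≤ lam → ∀ s : ℝ, 0.01 ≤ s → s ≤ 1 →
        ∀ S ∈ noiselessCommunity m q s, ∀ σ : Equiv.Perm (Fin (m * q)),
          IsSuboptimalBy (communityModel s lam) S σ (bidAlg S)
            (c * lam * ((m * q : ℕ) : ℝ) / (Real.logb 2 ((m * q : ℕ) : ℝ)) ^ 2) ∧
          IsSuboptimalBy (communityModel s lam) S σ (randAlg (m * q) (m * q))
            (c * ((m * q : ℕ) : ℝ)) := by
  constructor
  · intro m q hm hq lam hlam s hs _ S hS σ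
    obtain ⟨cr, cp, hS⟩ := exists_isCommunityMatrix hS
    have hs0 : 0 < s := by norm_num at hs; linarith
    have : NeZero (m * q) := ⟨(Nat.mul_pos (by omega) (by omega)).ne'⟩
    exact ⟨fun A hA A' => (hS.expectedGain_le hs0 hlam σ A').trans
        (hS.le_expectedGain_superStar hs0 σ hA),
      fun A' => (hS.expectedGain_le hs0 hlam σ A').trans (hS.le_expectedGain_simAlg hs0 σ)⟩
  · refine ⟨1 / 10000, by norm_num, ?_⟩
    intro m q hm hq lam hlam s hs _ S hS σ
    obtain ⟨cr, cp, hS⟩ := exists_isCommunityMatrix hS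
    have hs' : (1 : ℝ) / 100 ≤ s := by norm_num at hs ⊢; linarith
    have hs0 : 0 < s := by linarith
    have : NeZero (m * q) := ⟨(Nat.mul_pos (by omega) (by omega)).ne'⟩
    have h2q : 2 * q ≤ m * q := Nat.mul_le_mul_right q hm
    have hsim := hS.le_expectedGain_simAlg (lam := lam) hs0 σ
    refine ⟨⟨simAlg S, ?_⟩, ⟨simAlg S, ?_⟩⟩
    · -- `BID` loses in the steps at times `0, …, d - q - ⌊q / 8⌋`
      obtain ⟨T, hT⟩ : ∃ T, T + (q + q / 8) = m * q + 1 := ⟨m * q + 1 - (q + q / 8), by omega⟩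
      refine le_trans ?_ hsim
      have hbid := hS.expectedGain_bidAlg_le hs0 hlam (by omega) hT.le (by omega) σ
      -- the number of lossy steps is at least a constant fraction of `d`
      have hcount : (3 : ℝ) / 16 * (m * q : ℕ) ≤ T - m := by
        have h8 : ((q / 8 : ℕ) : ℝ) ≤ q / 8 := by exact_mod_cast Nat.cast_div_le
        have hT' : (T : ℝ) + (q + (q / 8 : ℕ)) = m * q + 1 := by exact_mod_cast hT
        have hm' : (2 : ℝ) ≤ m := by exact_mod_cast hm
        have hq' : (2 : ℝ) ≤ q := by exact_mod_cast hq
        push_cast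
        nlinarith [mul_nonneg (sub_nonneg.2 hm') (sub_nonneg.2 hq')]
      have hloss := le_displacementLoss hq h2q
      have h2s : (69 : ℝ) / 10000 ≤ 2 ^ s - 1 := by
        have h1 := Real.add_one_le_exp (Real.log 2 * s)
        rw [← Real.rpow_def_of_pos two_pos] at h1
        nlinarith [Real.log_two_gt_d9]
      set D : ℝ := ((m * q : ℕ) : ℝ) with hD
      set Λ := Real.logb 2 D ^ 2
      have hΛ : 0 ≤ Λ := sq_nonneg _
      have hD0 : 0 ≤ D := Nat.cast_nonneg _
      have hfinal : 1 / 10000 * lam * D / Λ ≤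
          lam * ((2 ^ s - 1) * displacementLoss q) * (T - m) := by
        calc 1 / 10000 * lam * D / Λ
            ≤ lam * (69 / 10000 * (1 / 9 / Λ)) * (3 / 16 * D) := by
              have : 0 ≤ lam * D / Λ := by positivity
              calc _ = 1 / 10000 * (lam * D / Λ) := by ring
                _ ≤ (69 / 10000 * (1 / 9) * (3 / 16)) * (lam * D / Λ) := by
                  gcongr
                  norm_num
                _ = _ := by ring
          _ ≤ _ := by
              have h0 : 0 ≤ displacementLoss q := le_trans (by positivity) hloss
              have h1 : (0 : ℝ) ≤ 2 ^ s - 1 := by linarith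
              gcongr
      linarith
    · have hrand := hS.expectedGain_randAlg_le hs0 hlam h2q σ
      have hD0 : (0 : ℝ) ≤ ((m * q : ℕ) : ℝ) := Nat.cast_nonneg _
      linarith
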